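/- Let $e\ge 2$ and $0\le m<e$ be integers. Write a bipartition as $\lambda=(\lambda^{(1)},\lambda^{(2)})$ with $\lambda^{(c)}=(\lambda^{(c)}_0\ge\lambda^{(c)}_1\ge\cdots)$, and identify it with its diagram $\{(a,b,c)\mid a\ge 0,\ c\in\{1,2\},\ 0\le b<\lambda^{(c)}_a\}$. The residue of $\gamma=(a,b,c)$ is $\operatorname{res}(\gamma)=b-a+m \bmod e$ if $c=1$ and $b-a \bmod e$ if $c=2$. If $\mu=\lambda\sqcup\{\gamma\}$ for bipartitions $\lambda,\mu$ and $\operatorname{res}(\gamma)=i$, then $\gamma$ is a removable $i$-node of $\mu$ and an addable $i$-node of $\lambda$. A node $(a,b,c)$ is above $(a',b',c')$ (and the latter is below the former) if $c<c'$, or $c=c'$ and $a<a'$. A removable $i$-node $\gamma$ of $\lambda$ is *normal* if, for every addable $i$-node $\eta$ of $\lambda$ below $\gamma$, there are more removable than addable $i$-nodes of $\lambda$ strictly between $\gamma$ and $\eta$; the highest normal $i$-node is called *good*. A bipartition is *Kleshchev* if it is $\emptyset=(\emptyset,\emptyset)$ or if, for some $i$, removing its good $i$-node gives a Kleshchev bipartition.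 An *admissible sequence of $i$-nodes* for $\lambda$ consists of removable $i$-nodes $R_1,\dots,R_s$ ($s\ge1$) of $\lambda$ such that they are the lowest $s$ removable $i$-nodes of $\lambda$, every addable $i$-node of $\lambda$ is above all of them, and every removable $i$-node $R$ of $\lambda$ above all of $R_1,\dots,R_s$ has an addable $i$-node of $\lambda$ below it. An *optimal sequence* $i_1^{a_1},\dots,i_p^{a_p}$ of $\lambda$ is one for which there are bipartitions $\lambda=\lambda[1],\lambda[2],\dots,\lambda[p+1]=\emptyset$ such that, for $1\le j\le p$, $\lambda[j]$ is the disjoint union of $\lambda[j+1]$ and an admissible sequence of $a_j$ $i_j$-nodes for $\lambda[j]$. The level-two deformed Fock space is the $\mathbb Q(v)$-vector space with basis the set of all bipartitions, on which $$f_i\lambda=\sum_{\mu=\lambda\sqcup\{\gamma\},\ \operatorname{res}(\gamma)=i} v^{N_i(\lambda,\mu)}\,\mu ,$$ where $N_i(\lambda,\mu)$ is the number of addable $i$-nodes of $\lambda$ below $\gamma$ minus the number of removable $i$-nodes of $\lambda$ below $\gamma$. Put $f_i^{(a)}=f_i^a/[a]!$, where $[n]=(v^n-v^{-n})/(v-v^{-1})$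 and $[a]!=[1][2]\cdots[a]$. Write $\nu\prec\lambda$ if either there is $j\ge0$ with $\nu^{(2)}_k=\lambda^{(2)}_k$ for all $k>j$ and $\nu^{(2)}_j<\lambda^{(2)}_j$, or $\nu^{(2)}=\lambda^{(2)}$ and there is $j\ge0$ with $\nu^{(1)}_k=\lambda^{(1)}_k$ for all $k>j$ and $\nu^{(1)}_j<\lambda^{(1)}_j$. **Proposition.** Let $\lambda$ be a Kleshchev bipartition and let $i_1^{a_1},\dots,i_p^{a_p}$ be an optimal sequence of $\lambda$. Then $$f_{i_1}^{(a_1)}\cdots f_{i_p}^{(a_p)}\emptyset=\lambda+\sum_{\nu\prec\lambda}c_{\nu,\lambda}(v)\,\nu$$ for some Laurent polynomials $c_{\nu,\lambda}(v)\in\mathbb Z_{\ge0}[v,v^{-1}]$, only finitely many of them nonzero. -/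

import Mathlib

open scoped LaurentPolynomial

/-- A bipartition `(λ⁽¹⁾, λ⁽²⁾)`, each partition being given by its Young diagram:
`lam 0` is `λ⁽¹⁾` and `lam 1` is `λ⁽²⁾`; the part `λ⁽ᶜ⁾_a` (`a ≥ 0`) is the row length
`(lam _).rowLen a`. The empty bipartition is `⊥`. -/
abbrev Bipartition : Type := Fin 2 → YoungDiagram

/-- A position `(a, b, c)`: row `a ≥ 0`, column `b ≥ 0`, component `c` (here `0` stands for the
first and `1` for the second component). -/
@[ext]
structure Node where
  row : ℕ
  col : ℕ
  comp : Fin 2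

namespace Bipartition

/-- The diagram of a bipartition. -/
def diagram (lam : Bipartition) : Set Node :=
  {γ | (γ.row, γ.col) ∈ lam γ.comp}

theorem mem_diagram_iff_lt (lam : Bipartition) (γ : Node) :
    γ ∈ lam.diagram ↔ γ.col < (lam γ.comp).rowLen γ.row :=
  YoungDiagram.mem_iff_lt_rowLen

theorem diagram_injective : Function.Injective diagram := by
  intro lam mu h
  funext c
  apply SetLike.ext
  rintro ⟨a, b⟩
  exact Set.ext_iff.mp h ⟨a, b, c⟩

theorem finite_diagram (lam : Bipartition) : lam.diagram.Finite := by
  have h : lam.diagram ⊆ ⋃ c : Fin 2,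
      (fun p : ℕ × ℕ => (⟨p.1, p.2, c⟩ : Node)) '' ((lam c).cells : Set (ℕ × ℕ)) := by
    intro γ hγ
    exact Set.mem_iUnion.mpr ⟨γ.comp, (γ.row, γ.col), hγ, rfl⟩
  exact (Set.finite_iUnion fun c => ((lam c).cells.finite_toSet).image _).subset h

/-- `mu = lam ⊔ {γ}`. -/
def AddsTo (lam : Bipartition) (γ : Node) (mu : Bipartition) : Prop :=
  γ ∉ lam.diagram ∧ mu.diagram = insert γ lam.diagram

/-- The pairs `(γ, mu)` with `mu = lam ⊔ {γ}` are finite in number. -/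
theorem finite_addsTo (lam : Bipartition) :
    {p : Node × Bipartition | lam.AddsTo p.1 p.2}.Finite := by
  have hinj : Set.InjOn (Prod.fst : Node × Bipartition → Node)
      {p : Node × Bipartition | lam.AddsTo p.1 p.2} := by
    rintro ⟨γ, mu⟩ h ⟨γ', mu'⟩ h' (rfl : γ = γ')
    have : mu = mu' := diagram_injective (h.2.trans h'.2.symm)
    rw [this]
  refine Set.Finite.of_finite_image (f := Prod.fst) ?_ hinj
  have hfin : (((fun γ : Node => (⟨γ.row, γ.col + 1, γ.comp⟩ : Node)) '' lam.diagram) ∪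
      ((fun γ : Node => (⟨γ.row + 1, γ.col, γ.comp⟩ : Node)) '' lam.diagram) ∪
      Set.range (fun c : Fin 2 => (⟨0, 0, c⟩ : Node))).Finite :=
    (((finite_diagram lam).image _).union ((finite_diagram lam).image _)).union
      (Set.finite_range _)
  refine hfin.subset ?_
  rintro _ ⟨⟨⟨a, b, c⟩, mu⟩, ⟨-, h2⟩, rfl⟩
  have hmem : (⟨a, b, c⟩ : Node) ∈ mu.diagram := h2 ▸ Set.mem_insert _ _
  rcases b with _ | b
  · rcases a with _ | a
    · exact Or.inr ⟨c, rfl⟩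
    · refine Or.inl (Or.inr ⟨⟨a, 0, c⟩, ?_, rfl⟩)
      have hm : (⟨a, 0, c⟩ : Node) ∈ mu.diagram :=
        (mu c).up_left_mem (Nat.le_succ a) le_rfl hmem
      rw [h2] at hm
      exact hm.resolve_left (by simp)
  · refine Or.inl (Or.inl ⟨⟨a, b, c⟩, ?_, rfl⟩)
    have hm : (⟨a, b, c⟩ : Node) ∈ mu.diagram :=
      (mu c).up_left_mem le_rfl (Nat.le_succ b) hmem
    rw [h2] at hm
    exact hm.resolve_left (by simp)

end Bipartition

/-- The residue modulo `e` of a node: `b - a + m` in the first component, `b - a` in the second. -/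
def Node.res (e m : ℕ) (γ : Node) : ZMod e :=
  (γ.col : ZMod e) - (γ.row : ZMod e) + (if γ.comp = 0 then (m : ZMod e) else 0)

/-- `γ` is above `γ'`: it lies in an earlier component, or in the same component and a higher
row. -/
def Node.Above (γ γ' : Node) : Prop :=
  γ.comp < γ'.comp ∨ (γ.comp = γ'.comp ∧ γ.row < γ'.row)

namespace Bipartition

/-- `γ` is an addable `i`-node of `lam`. -/
def IsAddable (e m : ℕ) (i : ZMod e) (lam : Bipartition) (γ : Node) : Prop :=
  γ.res e m = i ∧ ∃ mu : Bipartition, lam.AddsTo γ mu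

/-- `γ` is a removable `i`-node of `lam`. -/
def IsRemovable (e m : ℕ) (i : ZMod e) (lam : Bipartition) (γ : Node) : Prop :=
  γ.res e m = i ∧ ∃ mu : Bipartition, mu.AddsTo γ lam

theorem finite_isAddable (e m : ℕ) (i : ZMod e) (lam : Bipartition) :
    {γ | lam.IsAddable e m i γ}.Finite := by
  refine ((finite_addsTo lam).image Prod.fst).subset ?_
  rintro γ ⟨-, mu, h⟩
  exact ⟨(γ, mu), h, rfl⟩

theorem finite_isRemovable (e m : ℕ) (i : ZMod e) (lam : Bipartition) :
    {γ | lam.IsRemovable e m i γ}.Finite := by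
  refine (finite_diagram lam).subset ?_
  rintro γ ⟨-, mu, h⟩
  rw [h.2]
  exact Set.mem_insert _ _

/-- `γ` is a normal `i`-node of `lam`: it is a removable `i`-node and, for every addable `i`-node
`η` below `γ`, there are more removable than addable `i`-nodes strictly between `η` and `γ`. -/
def IsNormal (e m : ℕ) (i : ZMod e) (lam : Bipartition) (γ : Node) : Prop :=
  lam.IsRemovable e m i γ ∧
    ∀ η : Node, lam.IsAddable e m i η → γ.Above η →
      {δ | lam.IsAddable e m i δ ∧ γ.Above δ ∧ δ.Above η}.ncard <
        {δ | lam.IsRemovable e m i δ ∧ γ.Above δ ∧ δ.Above η}.ncard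

/-- The good `i`-node: the highest normal `i`-node. -/
def IsGood (e m : ℕ) (i : ZMod e) (lam : Bipartition) (γ : Node) : Prop :=
  lam.IsNormal e m i γ ∧ ∀ δ : Node, lam.IsNormal e m i δ → δ ≠ γ → γ.Above δ

/-- Kleshchev bipartitions: those that can be reduced to the empty bipartition by successively
removing good nodes. -/
inductive IsKleshchev (e m : ℕ) : Bipartition → Prop
  | empty : IsKleshchev e m ⊥
  | step (lam mu : Bipartition) (i : ZMod e) (γ : Node) (hgood : lam.IsGood e m i γ)
      (hrem : mu.AddsTo γ lam) (hmu : IsKleshchev e m mu) : IsKleshchev e m lam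

/-- `R` is (the set of nodes of) an admissible sequence of `i`-nodes for `lam`. -/
structure IsAdmissible (e m : ℕ) (i : ZMod e) (lam : Bipartition) (R : Finset Node) : Prop where
  nonempty : R.Nonempty
  removable : ∀ γ ∈ R, lam.IsRemovable e m i γ
  lowest : ∀ δ : Node, lam.IsRemovable e m i δ → δ ∉ R → ∀ γ ∈ R, δ.Above γ
  addable_above : ∀ η : Node, lam.IsAddable e m i η → ∀ γ ∈ R, η.Above γ
  addable_below : ∀ δ : Node, lam.IsRemovable e m i δ → (∀ γ ∈ R, δ.Above γ) →
    ∃ η : Node, lam.IsAddable e m i η ∧ δ.Above η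

/-- `IsOptimalSeq e m lam [(i₁, a₁), …, (i_p, a_p)]` says that `i₁^{a₁}, …, i_p^{a_p}` is an optimal
sequence of `lam`: there are bipartitions `lam = lam[1], …, lam[p+1] = ∅` such that `lam[j]` is the
disjoint union of `lam[j+1]` and an admissible sequence of `a_j` `i_j`-nodes for `lam[j]`. -/
inductive IsOptimalSeq (e m : ℕ) : Bipartition → List (ZMod e × ℕ) → Prop
  | nil : IsOptimalSeq e m ⊥ []
  | cons (lam mu : Bipartition) (i : ZMod e) (R : Finset Node) (L : List (ZMod e × ℕ))
      (hadm : lam.IsAdmissible e m i R)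
      (hdisj : Disjoint mu.diagram (R : Set Node))
      (hunion : lam.diagram = mu.diagram ∪ (R : Set Node))
      (hmu : IsOptimalSeq e m mu L) : IsOptimalSeq e m lam ((i, R.card) :: L)

/-- `RevLexLT lam nu` is the reverse lexicographic order `lam ≺ nu`. -/
def RevLexLT (lam nu : Bipartition) : Prop :=
  (∃ j : ℕ, (∀ k, j < k → (lam 1).rowLen k = (nu 1).rowLen k) ∧
      (lam 1).rowLen j < (nu 1).rowLen j) ∨
  (∃ j : ℕ, lam 1 = nu 1 ∧ (∀ k, j < k → (lam 0).rowLen k = (nu 0).rowLen k) ∧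
      (lam 0).rowLen j < (nu 0).rowLen j)

/-- The finite set of pairs `(γ, mu)` with `mu = lam ⊔ {γ}` and `γ` an addable `i`-node. -/
noncomputable def extensions (e m : ℕ) (i : ZMod e) (lam : Bipartition) :
    Finset (Node × Bipartition) :=
  ((finite_addsTo lam).subset (fun _ hp => hp.2 :
    {p : Node × Bipartition | p.1.res e m = i ∧ lam.AddsTo p.1 p.2} ⊆ _)).toFinset

theorem mem_extensions (e m : ℕ) (i : ZMod e) (lam : Bipartition) (p : Node × Bipartition) :
    p ∈ lam.extensions e m i ↔ p.1.res e m = i ∧ lam.AddsTo p.1 p.2 := by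
  simp [extensions]

/-- The number of addable `i`-nodes of `lam` below `γ` minus the number of removable `i`-nodes of
`lam` below `γ`. -/
noncomputable def belowCount (e m : ℕ) (i : ZMod e) (lam : Bipartition) (γ : Node) : ℤ :=
  ({δ | lam.IsAddable e m i δ ∧ γ.Above δ}.ncard : ℤ) -
    ({δ | lam.IsRemovable e m i δ ∧ γ.Above δ}.ncard : ℤ)

end Bipartition

/-- The level two deformed Fock space over `ℚ(v)`, with basis the bipartitions. -/
abbrev Fock : Type := Bipartition →₀ RatFunc ℚ

namespace Fock

/-- The indeterminate `v` of `ℚ(v)`, as a unit. -/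
noncomputable def v : (RatFunc ℚ)ˣ := Units.mk0 RatFunc.X RatFunc.X_ne_zero

/-- The basis vector of the Fock space attached to a bipartition. -/
noncomputable def basisVec (lam : Bipartition) : Fock := Finsupp.single lam 1

/-- The Chevalley generator `f_i` acting on the deformed Fock space:
`f_i lam = ∑ v ^ N_i(lam, mu) mu`, over all `mu = lam ⊔ {γ}` with `res γ = i`, where `N_i(lam, mu)`
is the number of addable minus the number of removable `i`-nodes of `lam` below `γ`. -/
noncomputable def f (e m : ℕ) (i : ZMod e) : Module.End (RatFunc ℚ) Fock :=
  Finsupp.linearCombination (RatFunc ℚ) fun lam : Bipartition =>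
    ∑ p ∈ lam.extensions e m i,
      ((v ^ lam.belowCount e m i p.1 : (RatFunc ℚ)ˣ) : RatFunc ℚ) • basisVec p.2

/-- The quantum integer `[n] = (v ^ n - v ^ (-n)) / (v - v ^ (-1))`. -/
noncomputable def qInt (n : ℕ) : RatFunc ℚ :=
  ((v : RatFunc ℚ) ^ n - ((v : RatFunc ℚ)⁻¹) ^ n) / ((v : RatFunc ℚ) - (v : RatFunc ℚ)⁻¹)

/-- The quantum factorial `[n]! = [1][2]⋯[n]`. -/
noncomputable def qFactorial (n : ℕ) : RatFunc ℚ :=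
  ∏ k ∈ Finset.range n, qInt (k + 1)

/-- The divided power `f_i^{(a)} = f_i ^ a / [a]!`. -/
noncomputable def dividedPower (e m : ℕ) (i : ZMod e) (a : ℕ) : Module.End (RatFunc ℚ) Fock :=
  (qFactorial a)⁻¹ • (f e m i) ^ a

/-- The embedding of `ℤ_{≥0}[v, v⁻¹]` into `ℚ(v)`. -/
noncomputable def ofLaurent : ℕ[T;T⁻¹] →+* RatFunc ℚ :=
  LaurentPolynomial.eval₂ (Nat.castRingHom (RatFunc ℚ)) v

end Fock

/-!
Let `mu` be obtained from `lam` by removing an admissible sequence `R` of `a` `i`-nodes. The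
theorem follows by induction along the optimal sequence once it is known that `f_i^{(a)}` maps a
vector which is unitriangular with respect to `mu` to one which is unitriangular with respect to
`lam` (`Fock.IsUnitriangular.dividedPower`). Two facts are needed.

The first is an explicit formula, `Fock.dividedPower_basisVec`: `f_i^{(a)} nu` is the sum of
`v ^ exponent(S) • (nu ⊔ S)` over the sets `S` of `a` addable `i`-nodes of `nu`, where
`exponent(S)` is the sum of `belowCount` over `S` minus `a.choose 2`. Since `e ≥ 2`,
adjoining an `i`-node does not affect the other addable or removable `i`-nodes, so
adjoining `γ` after `T` has the weight
`v ^ (belowCount nu γ - 2 * #{δ ∈ T below γ})`; summing over the orders in which `S` can be adjoined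
gives the factor `[a]!`, up to a power of `v`. In particular all coefficients are powers of `v`,
and the one of `lam` in `f_i^{(a)} mu` is `1` (`Fock.exponent_eq_zero`).

The second is the compatibility with the order
(`Bipartition.IsAdmissible.revLexLT_of_ne` and
`Bipartition.IsAdmissible.revLexLT_of_revLexLT`): if `nu` is
`mu` or smaller, and `S` is a set of `a` addable `i`-nodes of `nu`, then
`nu ⊔ S` is smaller than `lam`, except if `nu = mu` and `S = R`. The nodes
of `R` are the `a` lowest addable `i`-nodes of `mu`, and the order compares the lowest rows first,
so the rows below the first difference `x` between `nu` and `mu` become at most those of `lam`. If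
they become equal and row `x` of `nu ⊔ S` catches up with that of `lam`, then row `x` of `mu` ends
with a removable `i`-node which is not in `R`, and counting nodes shows that some node of `R` lies
above it; this is excluded for an admissible sequence.
-/

/-! ### Addable and removable nodes -/

namespace Node

/-- The position of the row of a node, ordered so that the lower rows are the larger ones. -/
def pos (γ : Node) : Fin 2 ×ₗ ℕ := toLex (γ.comp, γ.row)

theorem above_iff_pos_lt (γ δ : Node) : γ.Above δ ↔ γ.pos < δ.pos := by
  simp [Above, pos, Prod.Lex.toLex_lt_toLex]

theorem res_col_succ_ne {e m : ℕ} (he : 2 ≤ e) (a b : ℕ) (c : Fin 2) :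
    Node.res e m ⟨a, b + 1, c⟩ ≠ Node.res e m ⟨a, b, c⟩ := by
  have : Fact (1 < e) := ⟨he⟩
  intro h
  simp only [res, Nat.cast_add, Nat.cast_one] at h
  exact one_ne_zero (α := ZMod e) (by linear_combination h)

theorem res_row_succ_ne {e m : ℕ} (he : 2 ≤ e) (a b : ℕ) (c : Fin 2) :
    Node.res e m ⟨a + 1, b, c⟩ ≠ Node.res e m ⟨a, b, c⟩ := by
  have : Fact (1 < e) := ⟨he⟩
  intro h
  simp only [res, Nat.cast_add, Nat.cast_one] at h
  exact one_ne_zero (α := ZMod e) (by linear_combination -h)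

end Node

namespace Bipartition

theorem mem_diagram_of_le {lam : Bipartition} {a b a' b' : ℕ} {c : Fin 2} (ha : a' ≤ a)
    (hb : b' ≤ b) (h : (⟨a, b, c⟩ : Node) ∈ lam.diagram) :
    (⟨a', b', c⟩ : Node) ∈ lam.diagram :=
  (lam c).up_left_mem ha hb h

/-- A finite set of nodes closed under moving one step left and one step up is a diagram. -/
theorem exists_diagram_eq {D : Set Node} (hD : D.Finite)
    (hleft : ∀ a b c, (⟨a, b + 1, c⟩ : Node) ∈ D → (⟨a, b, c⟩ : Node) ∈ D)
    (hup : ∀ a b c, (⟨a + 1, b, c⟩ : Node) ∈ D → (⟨a, b, c⟩ : Node) ∈ D) :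
    ∃ mu : Bipartition, mu.diagram = D := by
  classical
  have hmem : ∀ (c : Fin 2) (p : ℕ × ℕ),
      p ∈ (hD.toFinset.filter fun γ => γ.comp = c).image (fun γ => (γ.row, γ.col)) ↔
        (⟨p.1, p.2, c⟩ : Node) ∈ D := by
    rintro c ⟨a, b⟩
    simp only [Finset.mem_image, Finset.mem_filter, Set.Finite.mem_toFinset, Prod.mk.injEq]
    constructor
    · rintro ⟨⟨_, _, _⟩, ⟨h, rfl⟩, rfl, rfl⟩
      exact h
    · intro h
      exact ⟨_, ⟨h, rfl⟩, rfl, rfl⟩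
  refine ⟨fun c => ⟨(hD.toFinset.filter fun γ => γ.comp = c).image (fun γ => (γ.row, γ.col)),
    ?_⟩, ?_⟩
  · rintro ⟨a, b⟩ ⟨a', b'⟩ ⟨ha, hb⟩ h
    rw [Finset.mem_coe, hmem] at h ⊢
    have hb' : (⟨a, b', c⟩ : Node) ∈ D :=
      Nat.decreasingInduction' (P := fun b => (⟨a, b, c⟩ : Node) ∈ D)
        (fun k _ _ => hleft a k c) hb h
    exact Nat.decreasingInduction' (P := fun a => (⟨a, b', c⟩ : Node) ∈ D)
      (fun k _ _ => hup k b' c) ha hb'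
  · ext ⟨a, b, c⟩
    exact hmem c (a, b)

theorem exists_addsTo_iff (lam : Bipartition) (γ : Node) :
    (∃ mu, lam.AddsTo γ mu) ↔ γ ∉ lam.diagram ∧
      (∀ b, γ.col = b + 1 → (⟨γ.row, b, γ.comp⟩ : Node) ∈ lam.diagram) ∧
      (∀ a, γ.row = a + 1 → (⟨a, γ.col, γ.comp⟩ : Node) ∈ lam.diagram) := by
  obtain ⟨r, s, t⟩ := γ
  constructor
  · rintro ⟨mu, h1, h2⟩
    have hγ : (⟨r, s, t⟩ : Node) ∈ mu.diagram := h2 ▸ Set.mem_insert _ _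
    refine ⟨h1, ?_, ?_⟩
    · rintro b rfl
      have := mem_diagram_of_le le_rfl (Nat.le_succ b) hγ
      rw [h2] at this
      exact this.resolve_left (by simp)
    · rintro a rfl
      have := mem_diagram_of_le (Nat.le_succ a) le_rfl hγ
      rw [h2] at this
      exact this.resolve_left (by simp)
  · rintro ⟨h1, h2, h3⟩
    obtain ⟨mu, hmu⟩ := exists_diagram_eq (D := insert ⟨r, s, t⟩ lam.diagram)
      ((finite_diagram lam).insert _)
      (by
        rintro a b c (h | h)
        · obtain ⟨rfl, rfl, rfl⟩ := Node.mk.inj h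
          exact Or.inr (h2 b rfl)
        · exact Or.inr (mem_diagram_of_le le_rfl (Nat.le_succ b) h))
      (by
        rintro a b c (h | h)
        · obtain ⟨rfl, rfl, rfl⟩ := Node.mk.inj h
          exact Or.inr (h3 a rfl)
        · exact Or.inr (mem_diagram_of_le (Nat.le_succ a) le_rfl h))
    exact ⟨mu, h1, hmu⟩

theorem exists_removesTo_iff (lam : Bipartition) (γ : Node) :
    (∃ mu : Bipartition, mu.AddsTo γ lam) ↔ γ ∈ lam.diagram ∧
      (⟨γ.row, γ.col + 1, γ.comp⟩ : Node) ∉ lam.diagram ∧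
      (⟨γ.row + 1, γ.col, γ.comp⟩ : Node) ∉ lam.diagram := by
  obtain ⟨r, s, t⟩ := γ
  constructor
  · rintro ⟨mu, h1, h2⟩
    refine ⟨h2 ▸ Set.mem_insert _ _, fun h => h1 ?_, fun h => h1 ?_⟩
    · rw [h2] at h
      exact mem_diagram_of_le le_rfl (Nat.le_succ s) (h.resolve_left (by simp))
    · rw [h2] at h
      exact mem_diagram_of_le (Nat.le_succ r) le_rfl (h.resolve_left (by simp))
  · rintro ⟨h1, h2, h3⟩
    obtain ⟨mu, hmu⟩ := exists_diagram_eq (D := lam.diagram \ {⟨r, s, t⟩})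
      ((finite_diagram lam).sdiff)
      (by
        rintro a b c ⟨h, -⟩
        refine ⟨mem_diagram_of_le le_rfl (Nat.le_succ b) h, fun h' => ?_⟩
        obtain ⟨rfl, rfl, rfl⟩ := Node.mk.inj h'
        exact h2 h)
      (by
        rintro a b c ⟨h, -⟩
        refine ⟨mem_diagram_of_le (Nat.le_succ a) le_rfl h, fun h' => ?_⟩
        obtain ⟨rfl, rfl, rfl⟩ := Node.mk.inj h'
        exact h3 h)
    refine ⟨mu, by rw [hmu]; simp, ?_⟩
    rw [hmu, Set.insert_sdiff_singleton, Set.insert_eq_of_mem h1]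

/-- `mu` is the disjoint union of `nu` and the finite set `S` of nodes of residue `i`. -/
structure AddsNodes (e m : ℕ) (i : ZMod e) (nu : Bipartition) (S : Finset Node)
    (mu : Bipartition) : Prop where
  res_eq : ∀ γ ∈ S, γ.res e m = i
  disjoint : ∀ γ ∈ S, γ ∉ nu.diagram
  mem_iff : ∀ γ, γ ∈ mu.diagram ↔ γ ∈ nu.diagram ∨ γ ∈ S

namespace AddsNodes

variable {e m : ℕ} {i : ZMod e} {nu mu : Bipartition} {S : Finset Node}

theorem eq_of_eq {mu' : Bipartition} (h : AddsNodes e m i nu S mu)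
    (h' : AddsNodes e m i nu S mu') : mu = mu' :=
  diagram_injective (Set.ext fun γ => (h.mem_iff γ).trans (h'.mem_iff γ).symm)

/-- Neighbouring nodes have different residues, as `e ≥ 2`, so adjoining `i`-nodes neither creates
nor destroys any other addable `i`-node. -/
theorem isAddable_iff (he : 2 ≤ e) (h : AddsNodes e m i nu S mu) (δ : Node) :
    mu.IsAddable e m i δ ↔ nu.IsAddable e m i δ ∧ δ ∉ S := by
  obtain ⟨r, s, t⟩ := δ
  simp only [IsAddable, exists_addsTo_iff, h.mem_iff, not_or]
  constructor
  · rintro ⟨hr, ⟨h1, h1'⟩, h2, h3⟩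
    refine ⟨⟨hr, h1, fun b hb => (h2 b hb).resolve_right fun hS => ?_,
      fun a ha => (h3 a ha).resolve_right fun hS => ?_⟩, h1'⟩
    · subst hb
      exact Node.res_col_succ_ne he _ _ _ (hr.trans (h.res_eq _ hS).symm)
    · subst ha
      exact Node.res_row_succ_ne he _ _ _ (hr.trans (h.res_eq _ hS).symm)
  · rintro ⟨⟨hr, h1, h2, h3⟩, h1'⟩
    exact ⟨hr, ⟨h1, h1'⟩, fun b hb => Or.inl (h2 b hb), fun a ha => Or.inl (h3 a ha)⟩

theorem isRemovable_iff (he : 2 ≤ e) (h : AddsNodes e m i nu S mu) (δ : Node) :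
    mu.IsRemovable e m i δ ↔ nu.IsRemovable e m i δ ∨ δ ∈ S := by
  obtain ⟨r, s, t⟩ := δ
  simp only [IsRemovable, exists_removesTo_iff, h.mem_iff, not_or]
  constructor
  · rintro ⟨hr, h1 | h1, h2, h3⟩
    · exact Or.inl ⟨hr, h1, h2.1, h3.1⟩
    · exact Or.inr h1
  · have key : Node.res e m ⟨r, s, t⟩ = i →
        (⟨r, s + 1, t⟩ : Node) ∉ S ∧ (⟨r + 1, s, t⟩ : Node) ∉ S := fun hr =>
      ⟨fun hS => Node.res_col_succ_ne he _ _ _ ((h.res_eq _ hS).trans hr.symm),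
        fun hS => Node.res_row_succ_ne he _ _ _ ((h.res_eq _ hS).trans hr.symm)⟩
    rintro (⟨hr, h1, h2, h3⟩ | hS)
    · exact ⟨hr, Or.inl h1, ⟨h2, (key hr).1⟩, h3, (key hr).2⟩
    · have hr := h.res_eq _ hS
      refine ⟨hr, Or.inr hS, ⟨fun h' => ?_, (key hr).1⟩, fun h' => ?_, (key hr).2⟩
      · exact h.disjoint _ hS (mem_diagram_of_le le_rfl (Nat.le_succ s) h')
      · exact h.disjoint _ hS (mem_diagram_of_le (Nat.le_succ r) le_rfl h')

theorem isAddable (he : 2 ≤ e) (h : AddsNodes e m i nu S mu) {δ : Node} (hδ : δ ∈ S) :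
    nu.IsAddable e m i δ := by
  obtain ⟨r, s, t⟩ := δ
  have hr := h.res_eq _ hδ
  have hmu := (h.mem_iff _).2 (Or.inr hδ)
  refine ⟨hr, (exists_addsTo_iff _ _).2 ⟨h.disjoint _ hδ, ?_, ?_⟩⟩
  · rintro b rfl
    refine ((h.mem_iff _).1 (mem_diagram_of_le le_rfl (Nat.le_succ b) hmu)).resolve_right
      fun hS => ?_
    exact Node.res_col_succ_ne he _ _ _ (hr.trans (h.res_eq _ hS).symm)
  · rintro a rfl
    refine ((h.mem_iff _).1 (mem_diagram_of_le (Nat.le_succ a) le_rfl hmu)).resolve_right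
      fun hS => ?_
    exact Node.res_row_succ_ne he _ _ _ (hr.trans (h.res_eq _ hS).symm)

end AddsNodes

theorem exists_addsNodes {e m : ℕ} {i : ZMod e} {nu : Bipartition} {S : Finset Node}
    (hS : ∀ γ ∈ S, nu.IsAddable e m i γ) : ∃ mu, AddsNodes e m i nu S mu := by
  have hS' := fun γ hγ => (exists_addsTo_iff nu γ).1 (hS γ hγ).2
  obtain ⟨mu, hmu⟩ := exists_diagram_eq (D := nu.diagram ∪ S)
    ((finite_diagram nu).union S.finite_toSet)
    (by
      rintro a b c (h | h)
      · exact Or.inl (mem_diagram_of_le le_rfl (Nat.le_succ b) h)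
      · exact Or.inl ((hS' _ h).2.1 b rfl))
    (by
      rintro a b c (h | h)
      · exact Or.inl (mem_diagram_of_le (Nat.le_succ a) le_rfl h)
      · exact Or.inl ((hS' _ h).2.2 a rfl))
  exact ⟨mu, fun γ hγ => (hS γ hγ).1, fun γ hγ => (hS' γ hγ).1, fun γ => by rw [hmu]; rfl⟩

open Classical in
/-- The bipartition obtained from `nu` by adjoining the nodes of `S`; the junk value is `nu` when
no such bipartition exists. -/
noncomputable def addNodes (nu : Bipartition) (S : Finset Node) : Bipartition :=
  if h : ∃ mu : Bipartition, mu.diagram = nu.diagram ∪ S then h.choose else nu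

theorem addsNodes_addNodes {e m : ℕ} {i : ZMod e} {nu : Bipartition} {S : Finset Node}
    (hS : ∀ γ ∈ S, nu.IsAddable e m i γ) : AddsNodes e m i nu S (nu.addNodes S) := by
  obtain ⟨mu, hmu⟩ := exists_addsNodes hS
  have h : ∃ mu : Bipartition, mu.diagram = nu.diagram ∪ S := ⟨mu, Set.ext hmu.mem_iff⟩
  refine ⟨hmu.res_eq, hmu.disjoint, fun γ => ?_⟩
  rw [addNodes, dif_pos h, h.choose_spec]
  rfl

theorem AddsNodes.eq_addNodes {e m : ℕ} {i : ZMod e} {nu mu : Bipartition} {S : Finset Node}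
    (he : 2 ≤ e) (h : AddsNodes e m i nu S mu) : mu = nu.addNodes S :=
  h.eq_of_eq (addsNodes_addNodes fun _ hγ => h.isAddable he hγ)

/-- The length of the row at position `x`. -/
def part (nu : Bipartition) (x : Fin 2 ×ₗ ℕ) : ℕ := (nu (ofLex x).1).rowLen (ofLex x).2

/-- The first node to the right of the row at position `x`: the only node of this row that can be
addable. -/
def rowEnd (nu : Bipartition) (x : Fin 2 ×ₗ ℕ) : Node := ⟨(ofLex x).2, nu.part x, (ofLex x).1⟩

@[simp]
theorem pos_rowEnd (nu : Bipartition) (x : Fin 2 ×ₗ ℕ) : (nu.rowEnd x).pos = x := rfl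

theorem mem_diagram_iff_lt_part (nu : Bipartition) (γ : Node) :
    γ ∈ nu.diagram ↔ γ.col < nu.part γ.pos :=
  mem_diagram_iff_lt nu γ

theorem IsAddable.eq_rowEnd {e m : ℕ} {i : ZMod e} {nu : Bipartition} {γ : Node}
    (h : nu.IsAddable e m i γ) : γ = nu.rowEnd γ.pos := by
  obtain ⟨r, s, t⟩ := γ
  obtain ⟨h1, h2, -⟩ := (exists_addsTo_iff _ _).1 h.2
  have : s = nu.part (toLex (t, r)) := by
    rw [mem_diagram_iff_lt_part, not_lt] at h1
    refine le_antisymm ?_ h1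
    rcases s with _ | b
    · exact Nat.zero_le _
    · exact (mem_diagram_iff_lt_part _ _).1 (h2 b rfl)
  simp only [rowEnd, Node.pos, ofLex_toLex, ← this]

theorem injOn_pos_isAddable (e m : ℕ) (i : ZMod e) (nu : Bipartition) :
    Set.InjOn Node.pos {γ | nu.IsAddable e m i γ} := by
  intro γ hγ δ hδ h
  rw [IsAddable.eq_rowEnd hγ, IsAddable.eq_rowEnd hδ, h]

end Bipartition

/-! ### The reverse lexicographic order -/

namespace Bipartition

variable {e m : ℕ} {i : ZMod e}

open Classical in
theorem AddsNodes.part_eq (he : 2 ≤ e) {nu mu : Bipartition} {S : Finset Node}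
    (h : AddsNodes e m i nu S mu) (x : Fin 2 ×ₗ ℕ) :
    mu.part x = nu.part x + if nu.rowEnd x ∈ S then 1 else 0 := by
  have key : ∀ b, b < mu.part x ↔ b < nu.part x ∨ (b = nu.part x ∧ nu.rowEnd x ∈ S) := by
    intro b
    have h1 := h.mem_iff ⟨(ofLex x).2, b, (ofLex x).1⟩
    rw [mem_diagram_iff_lt_part, mem_diagram_iff_lt_part] at h1
    refine h1.trans (or_congr_right ⟨fun hS => ?_, ?_⟩)
    · have h2 := (h.isAddable he hS).eq_rowEnd
      exact ⟨congrArg Node.col h2, h2 ▸ hS⟩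
    · rintro ⟨rfl, hS⟩
      exact hS
  have h0 := key (nu.part x)
  have h1 := key (nu.part x + 1)
  have h2 := key (mu.part x)
  split_ifs with hS <;> simp only [hS, and_true, and_false, or_false] at h0 h1 h2 <;> omega

theorem revLexLT_iff (lam nu : Bipartition) :
    RevLexLT lam nu ↔
      ∃ x, (∀ y, x < y → lam.part y = nu.part y) ∧ lam.part x < nu.part x := by
  have hlt : ∀ (c c' : Fin 2) (j j' : ℕ), (toLex (c, j) : Fin 2 ×ₗ ℕ) < toLex (c', j') ↔
      c < c' ∨ c = c' ∧ j < j' := fun c c' j j' => Prod.Lex.toLex_lt_toLex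
  constructor
  · rintro (⟨j, h1, h2⟩ | ⟨j, h0, h1, h2⟩)
    · refine ⟨toLex (1, j), fun y hy => ?_, h2⟩
      obtain ⟨⟨c, k⟩, rfl⟩ := toLex.surjective y
      rw [hlt] at hy
      obtain ⟨rfl, hk⟩ := hy.resolve_left (by omega)
      exact h1 k hk
    · refine ⟨toLex (0, j), fun y hy => ?_, h2⟩
      obtain ⟨⟨c, k⟩, rfl⟩ := toLex.surjective y
      rw [hlt] at hy
      rcases hy with hc | ⟨rfl, hk⟩
      · obtain rfl : c = 1 := by omega
        exact congrArg (fun Y => YoungDiagram.rowLen Y k) h0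
      · exact h1 k hk
  · rintro ⟨x, h1, h2⟩
    obtain ⟨⟨c, j⟩, rfl⟩ := toLex.surjective x
    obtain rfl | rfl : c = 0 ∨ c = 1 := by omega
    · refine Or.inr ⟨j, ?_, fun k hk => h1 (toLex (0, k)) ((hlt _ _ _ _).2 (Or.inr ⟨rfl, hk⟩)), h2⟩
      apply SetLike.ext
      rintro ⟨a, b⟩
      rw [YoungDiagram.mem_iff_lt_rowLen, YoungDiagram.mem_iff_lt_rowLen]
      exact iff_of_eq (congrArg (b < ·)
        (h1 (toLex (1, a)) ((hlt _ _ _ _).2 (Or.inl (by decide)))))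
    · exact Or.inl ⟨j, fun k hk => h1 (toLex (1, k)) ((hlt _ _ _ _).2 (Or.inr ⟨rfl, hk⟩)), h2⟩

theorem RevLexLT.ne {nu lam : Bipartition} (h : RevLexLT nu lam) : nu ≠ lam := by
  rintro rfl
  obtain ⟨x, -, hx⟩ := (revLexLT_iff _ _).1 h
  exact lt_irrefl _ hx

/-- An admissible sequence of `lam` consists of the lowest addable `i`-nodes of the bipartition
from which it is removed. -/
theorem IsAdmissible.above_of_isAddable (he : 2 ≤ e) {lam mu : Bipartition} {R : Finset Node}
    (hR : lam.IsAdmissible e m i R) (h : AddsNodes e m i mu R lam) {δ : Node}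
    (hδ : mu.IsAddable e m i δ) (hδR : δ ∉ R) : ∀ γ ∈ R, δ.Above γ :=
  hR.addable_above δ ((h.isAddable_iff he δ).2 ⟨hδ, hδR⟩)

/-- Let `P` cut out a lowest segment of rows on which `nu` and `mu` agree and on which the nodes
of `S` are addable to `mu`. Since `R` consists of the `|R|` lowest addable `i`-nodes of `mu`,
adjoining `R` maximizes the lowest rows: either adjoining `S` to `nu` gives a smaller bipartition,
or `S` and `R` meet the same rows of this segment. -/
theorem IsAdmissible.revLexLT_or_forall_mem_iff (he : 2 ≤ e) {lam mu nu nu' : Bipartition}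
    {R S : Finset Node} (hR : lam.IsAdmissible e m i R) (h : AddsNodes e m i mu R lam)
    (h' : AddsNodes e m i nu S nu') (hcard : S.card = R.card) (P : Fin 2 ×ₗ ℕ → Prop)
    (hP : ∀ x y, x < y → P x → P y) (hpart : ∀ y, P y → nu.part y = mu.part y)
    (hadd : ∀ y, P y → nu.rowEnd y ∈ S → mu.IsAddable e m i (nu.rowEnd y)) :
    RevLexLT nu' lam ∨ ∀ y, P y → (nu.rowEnd y ∈ S ↔ nu.rowEnd y ∈ R) := by
  classical
  by_contra! hcon
  obtain ⟨hlt, y₀, hy₀, hne₀⟩ := hcon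
  have hend : ∀ y, P y → nu.rowEnd y = mu.rowEnd y := fun y hy => by
    simp only [rowEnd, hpart y hy]
  let T : Finset (Fin 2 ×ₗ ℕ) :=
    ((S ∪ R).image Node.pos).filter fun y => P y ∧ ¬ (nu.rowEnd y ∈ S ↔ nu.rowEnd y ∈ R)
  have hT : ∀ y, y ∈ T ↔ P y ∧ ¬ (nu.rowEnd y ∈ S ↔ nu.rowEnd y ∈ R) := by
    intro y
    simp only [T, Finset.mem_filter, and_iff_right_iff_imp]
    rintro ⟨-, hne⟩
    refine Finset.mem_image.2 ⟨nu.rowEnd y, Finset.mem_union.2 ?_, rfl⟩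
    tauto
  -- The lowest row of the segment which is met by exactly one of `S` and `R`.
  obtain ⟨y, hyT, hmax⟩ := T.exists_max_image id ⟨y₀, (hT y₀).2 ⟨hy₀, by tauto⟩⟩
  obtain ⟨hPy, hne⟩ := (hT y).1 hyT
  have hagree : ∀ z, y < z → (nu.rowEnd z ∈ S ↔ nu.rowEnd z ∈ R) := fun z hz => by
    by_contra hz'
    exact (hmax z ((hT z).2 ⟨hP y z hz hPy, hz'⟩)).not_gt hz
  by_cases hyR : nu.rowEnd y ∈ R
  · have hyS : nu.rowEnd y ∉ S := fun hyS => hne (iff_of_true hyS hyR)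
    refine hlt ((revLexLT_iff _ _).2 ⟨y, fun z hz => ?_, ?_⟩)
    · have hPz := hP y z hz hPy
      rw [h'.part_eq he, h.part_eq he, hpart z hPz, ← hend z hPz]
      simp only [hagree z hz]
    · rw [h'.part_eq he, h.part_eq he, hpart y hPy, ← hend y hPy, if_neg hyS, if_pos hyR]
      exact Nat.lt_succ_self _
  · have hyS : nu.rowEnd y ∈ S := by tauto
    have habove := hR.above_of_isAddable he h (hadd y hPy hyS) hyR
    have hsub : insert (nu.rowEnd y) R ⊆ S := by
      refine Finset.insert_subset hyS fun γ hγ => ?_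
      have hlt' := (Node.above_iff_pos_lt _ _).1 (habove γ hγ)
      rw [pos_rowEnd] at hlt'
      have hγ' : γ = nu.rowEnd γ.pos :=
        (h.isAddable he hγ).eq_rowEnd.trans (hend _ (hP _ _ hlt' hPy)).symm
      rw [hγ']
      refine (hagree _ hlt').2 ?_
      rwa [← hγ']
    have := Finset.card_le_card hsub
    rw [Finset.card_insert_of_notMem hyR] at this
    omega

theorem IsAdmissible.revLexLT_of_ne (he : 2 ≤ e) {lam mu nu' : Bipartition}
    {R S : Finset Node} (hR : lam.IsAdmissible e m i R) (h : AddsNodes e m i mu R lam)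
    (h' : AddsNodes e m i mu S nu') (hcard : S.card = R.card) (hne : S ≠ R) :
    RevLexLT nu' lam := by
  refine (hR.revLexLT_or_forall_mem_iff he h h' hcard (fun _ => True) (fun _ _ _ _ => trivial)
    (fun _ _ => rfl) fun y _ hy => h'.isAddable he hy).resolve_right fun hall => hne ?_
  refine Finset.eq_of_subset_of_card_le (fun γ hγ => ?_) hcard.ge
  have hγ' := (h'.isAddable he hγ).eq_rowEnd
  rw [hγ'] at hγ ⊢
  exact (hall _ trivial).1 hγ

/-- Adjoining an admissible sequence to `mu` gives a bipartition larger than any obtained from a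
smaller bipartition by adjoining the same number of `i`-nodes. -/
theorem IsAdmissible.revLexLT_of_revLexLT (he : 2 ≤ e) {lam mu nu nu' : Bipartition}
    {R S : Finset Node} (hR : lam.IsAdmissible e m i R) (h : AddsNodes e m i mu R lam)
    (h' : AddsNodes e m i nu S nu') (hcard : S.card = R.card) (hlt : RevLexLT nu mu) :
    RevLexLT nu' lam := by
  classical
  obtain ⟨x, hpart, hx⟩ := (revLexLT_iff _ _).1 hlt
  have hend : ∀ y, x < y → nu.rowEnd y = mu.rowEnd y := fun y hy => by
    simp only [rowEnd, hpart y hy]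
  -- Below row `x` the two bipartitions agree, and row `x` is longer in `mu` than in `nu`.
  have hmono : ∀ γ : Node, x ≤ γ.pos → γ ∈ nu.diagram → γ ∈ mu.diagram := fun γ hγ hmem => by
    rw [mem_diagram_iff_lt_part] at hmem ⊢
    rcases hγ.eq_or_lt with rfl | hγ
    · exact hmem.trans hx
    · rwa [← hpart _ hγ]
  have hadd : ∀ y, x < y → nu.rowEnd y ∈ S → mu.IsAddable e m i (nu.rowEnd y) := by
    intro y hy hyS
    obtain ⟨hres, hex⟩ := h'.isAddable he hyS
    obtain ⟨-, h2, h3⟩ := (exists_addsTo_iff _ _).1 hex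
    refine ⟨hres, (exists_addsTo_iff _ _).2 ⟨?_, fun b hb => ?_, fun a ha => ?_⟩⟩
    · rw [mem_diagram_iff_lt_part, pos_rowEnd, ← hpart y hy]
      exact lt_irrefl _
    · exact hmono _ hy.le (h2 b hb)
    · refine hmono _ ?_ (h3 a ha)
      obtain ⟨⟨c, k⟩, rfl⟩ := toLex.surjective y
      obtain ⟨⟨d, j⟩, rfl⟩ := toLex.surjective x
      obtain rfl : k = a + 1 := ha
      refine Prod.Lex.toLex_le_toLex.2 ((Prod.Lex.toLex_lt_toLex.1 hy).imp_right ?_)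
      exact fun hj => ⟨hj.1, Nat.lt_succ_iff.1 hj.2⟩
  refine (hR.revLexLT_or_forall_mem_iff he h h' hcard (fun y => x < y)
    (fun _ _ hxy hx => hx.trans hxy) hpart hadd).elim id fun hall => ?_
  have hbelow : ∀ y, x < y → nu'.part y = lam.part y := fun y hy => by
    rw [h'.part_eq he, h.part_eq he, hpart y hy, ← hend y hy]
    simp only [hall y hy]
  refine (revLexLT_iff _ _).2 ⟨x, hbelow, ?_⟩
  by_contra hge
  rw [h'.part_eq he, h.part_eq he] at hge
  -- Row `x` can only catch up if `S` meets it, `R` does not, and the two rows differ by one.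
  obtain ⟨hxS, hxR, hx1⟩ : nu.rowEnd x ∈ S ∧ mu.rowEnd x ∉ R ∧ mu.part x = nu.part x + 1 := by
    split_ifs at hge with h1 h2 h2 <;> first | omega | exact ⟨h1, h2, by omega⟩
  -- Some node of `R` lies above row `x`, for otherwise `S` would contain more nodes than `R`.
  obtain ⟨γ, hγ, hγx⟩ : ∃ γ ∈ R, γ.pos < x := by
    by_contra! hcon
    have hsub : insert (nu.rowEnd x) R ⊆ S := by
      refine Finset.insert_subset hxS fun γ hγ => ?_
      have hγ' := (h.isAddable he hγ).eq_rowEnd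
      have hxγ : x < γ.pos := by
        refine (hcon γ hγ).lt_of_ne fun hxγ => hxR ?_
        rwa [hxγ, ← hγ']
      rw [hγ', ← hend _ hxγ]
      refine (hall _ hxγ).2 ?_
      rwa [hend _ hxγ, ← hγ']
    have hnot : nu.rowEnd x ∉ R := fun hmem => by
      have := (h.isAddable he hmem).eq_rowEnd
      rw [pos_rowEnd] at this
      exact hxR (this ▸ hmem)
    have := Finset.card_le_card hsub
    rw [Finset.card_insert_of_notMem hnot] at this
    omega
  -- The last node of row `x` of `mu` is a removable `i`-node which does not belong to `R`.
  have hmem : nu.rowEnd x ∈ mu.diagram := by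
    rw [mem_diagram_iff_lt_part, pos_rowEnd]
    exact hx
  have hrem : mu.IsRemovable e m i (nu.rowEnd x) := by
    refine ⟨h'.res_eq _ hxS, (exists_removesTo_iff _ _).2 ⟨hmem, ?_, ?_⟩⟩
    · rw [mem_diagram_iff_lt_part]
      exact not_lt.2 hx1.le
    · have hxx : x < toLex ((ofLex x).1, (ofLex x).2 + 1) :=
        Prod.Lex.toLex_lt_toLex.2 (Or.inr ⟨rfl, Nat.lt_succ_self _⟩)
      rw [mem_diagram_iff_lt_part]
      change ¬ nu.part x < mu.part (toLex ((ofLex x).1, (ofLex x).2 + 1))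
      rw [← hpart _ hxx, not_lt]
      exact (nu (ofLex x).1).rowLen_anti _ _ (Nat.le_succ _)
  have habove := hR.lowest _ ((h.isRemovable_iff he _).2 (Or.inl hrem))
    (fun hmem' => h.disjoint _ hmem' hmem) γ hγ
  rw [Node.above_iff_pos_lt, pos_rowEnd] at habove
  exact lt_asymm habove hγx

end Bipartition

/-! ### Quantum integers -/

namespace Fock

theorem v_pow_ne_inv_pow {n : ℕ} (hn : n ≠ 0) : (v : RatFunc ℚ) ^ n ≠ (v : RatFunc ℚ)⁻¹ ^ n := by
  intro h
  have h1 : (v : RatFunc ℚ) ^ (n + n) = 1 := by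
    rw [pow_add]
    nth_rewrite 1 [h]
    rw [← mul_pow, inv_mul_cancel₀ v.ne_zero, one_pow]
  have h2 : (Polynomial.X : Polynomial ℚ) ^ (n + n) = 1 := by
    apply RatFunc.algebraMap_injective ℚ
    rw [map_pow, RatFunc.algebraMap_X, map_one]
    exact h1
  have h3 := congrArg Polynomial.natDegree h2
  rw [Polynomial.natDegree_X_pow, Polynomial.natDegree_one] at h3
  omega

theorem v_sub_inv_ne_zero : (v : RatFunc ℚ) - (v : RatFunc ℚ)⁻¹ ≠ 0 := by
  simpa [sub_eq_zero] using v_pow_ne_inv_pow one_ne_zero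

theorem qInt_eq_sum (n : ℕ) :
    qInt (n + 1) =
      ∑ k ∈ Finset.range (n + 1), ((v ^ ((n : ℤ) - 2 * k) : (RatFunc ℚ)ˣ) : RatFunc ℚ) := by
  rw [qInt, div_eq_iff v_sub_inv_ne_zero, ← Commute.geom_sum₂_mul (Commute.all _ _)]
  congr 1
  rw [← Finset.sum_range_reflect]
  refine Finset.sum_congr rfl fun k hk => ?_
  have hk' := Finset.mem_range.1 hk
  obtain ⟨l, rfl⟩ := Nat.exists_eq_add_of_le (Nat.lt_succ_iff.1 hk')
  have h : ((k + l : ℕ) : ℤ) - 2 * k = (l : ℤ) - (k : ℤ) := by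
    push_cast
    ring
  rw [h, zpow_sub]
  simp

theorem qInt_succ_ne_zero (n : ℕ) : qInt (n + 1) ≠ 0 :=
  div_ne_zero (sub_ne_zero.2 (v_pow_ne_inv_pow n.succ_ne_zero)) v_sub_inv_ne_zero

theorem qFactorial_succ (n : ℕ) : qFactorial (n + 1) = qFactorial n * qInt (n + 1) :=
  Finset.prod_range_succ _ _

theorem qFactorial_ne_zero (n : ℕ) : qFactorial n ≠ 0 :=
  Finset.prod_ne_zero_iff.2 fun k _ => qInt_succ_ne_zero k

end Fock

/-- In a finite set whose elements have distinct keys, the numbers of elements with a larger key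
than a given one are `0, 1, 2, …`, each occurring once. -/
theorem Finset.sum_card_filter_key_lt {α β M : Type*} [LinearOrder β] [AddCommMonoid M]
    [DecidableEq α] (key : α → β) (g : ℕ → M) (S : Finset α) (hS : Set.InjOn key S) :
    ∑ γ ∈ S, g (S.filter fun δ => key γ < key δ).card = ∑ k ∈ Finset.range S.card, g k := by
  induction S using Finset.induction_on_min_value (f := key) with
  | empty => simp
  | insert a s ha hmin ih =>
    have hlt : ∀ x ∈ s, key a < key x := fun x hx => (hmin x hx).lt_of_ne fun h =>
      ha (hS (Finset.mem_insert_self _ _) (Finset.mem_insert_of_mem hx) h ▸ hx)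
    rw [Finset.sum_insert ha, Finset.card_insert_of_notMem ha, Finset.sum_range_succ_comm,
      ← ih (hS.mono (by simp))]
    congr 1
    · rw [Finset.filter_insert, if_neg (lt_irrefl _), Finset.filter_true_of_mem hlt]
    · refine Finset.sum_congr rfl fun x hx => ?_
      rw [Finset.filter_insert, if_neg (hlt x hx).not_gt]

/-! ### Divided powers of the Chevalley generators -/

namespace Bipartition

variable {e m : ℕ} {i : ZMod e}

/-- The finite set of addable `i`-nodes. -/
noncomputable def addableNodes (e m : ℕ) (i : ZMod e) (nu : Bipartition) : Finset Node :=
  (finite_isAddable e m i nu).toFinset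

@[simp]
theorem mem_addableNodes {nu : Bipartition} {γ : Node} :
    γ ∈ nu.addableNodes e m i ↔ nu.IsAddable e m i γ := by
  simp [addableNodes]

open Classical in
theorem AddsNodes.belowCount_eq (he : 2 ≤ e) {nu mu : Bipartition} {S : Finset Node}
    (h : AddsNodes e m i nu S mu) (γ : Node) :
    mu.belowCount e m i γ =
      nu.belowCount e m i γ - 2 * (S.filter fun δ => γ.pos < δ.pos).card := by
  have hadd : {δ | nu.IsAddable e m i δ ∧ γ.Above δ} =
      {δ | mu.IsAddable e m i δ ∧ γ.Above δ} ∪ (S.filter fun δ => γ.pos < δ.pos : Finset Node) := by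
    ext δ
    simp only [Set.mem_ofPred_eq, Set.mem_union, h.isAddable_iff he, Finset.coe_filter,
      Node.above_iff_pos_lt]
    have := h.isAddable he (δ := δ)
    tauto
  have hrem : {δ | mu.IsRemovable e m i δ ∧ γ.Above δ} =
      {δ | nu.IsRemovable e m i δ ∧ γ.Above δ} ∪
        (S.filter fun δ => γ.pos < δ.pos : Finset Node) := by
    ext δ
    simp only [Set.mem_ofPred_eq, Set.mem_union, h.isRemovable_iff he, Finset.coe_filter,
      Node.above_iff_pos_lt]
    tauto
  have hdadd : Disjoint {δ | mu.IsAddable e m i δ ∧ γ.Above δ}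
      (S.filter fun δ => γ.pos < δ.pos : Finset Node) :=
    Set.disjoint_left.2 fun δ h1 h2 =>
      ((h.isAddable_iff he δ).1 h1.1).2 (Finset.mem_filter.1 h2).1
  have hdrem : Disjoint {δ | nu.IsRemovable e m i δ ∧ γ.Above δ}
      (S.filter fun δ => γ.pos < δ.pos : Finset Node) :=
    Set.disjoint_left.2 fun δ h1 h2 =>
      h.disjoint δ (Finset.mem_filter.1 h2).1 ((exists_removesTo_iff _ _).1 h1.1.2).1
  rw [belowCount, belowCount, hadd, hrem,
    Set.ncard_union_eq hdadd ((finite_isAddable e m i mu).subset fun _ h => h.1)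
      (Finset.finite_toSet _),
    Set.ncard_union_eq hdrem ((finite_isRemovable e m i nu).subset fun _ h => h.1)
      (Finset.finite_toSet _), Set.ncard_coe_finset]
  push_cast
  ring

theorem AddsTo.addsNodes {nu mu : Bipartition} {γ : Node} (h : nu.AddsTo γ mu)
    (hres : γ.res e m = i) : AddsNodes e m i nu {γ} mu where
  res_eq := by simpa using hres
  disjoint := by simpa using h.1
  mem_iff δ := by rw [h.2, Set.mem_insert_iff, Finset.mem_singleton, or_comm]

end Bipartition

namespace Fock

open Bipartition

variable {e m : ℕ} {i : ZMod e}

theorem f_basisVec (he : 2 ≤ e) (nu : Bipartition) :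
    f e m i (basisVec nu) = ∑ γ ∈ nu.addableNodes e m i,
      ((v ^ nu.belowCount e m i γ : (RatFunc ℚ)ˣ) : RatFunc ℚ) • basisVec (nu.addNodes {γ}) := by
  rw [f, basisVec, Finsupp.linearCombination_single, one_smul]
  have hadd : ∀ p ∈ nu.extensions e m i, p.2 = nu.addNodes {p.1} := fun p hp => by
    obtain ⟨hr, h⟩ := (mem_extensions _ _ _ _ _).1 hp
    exact (h.addsNodes hr).eq_addNodes he
  refine Finset.sum_bij (fun p _ => p.1) (fun p hp => ?_) (fun p hp q hq hpq => ?_)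
    (fun γ hγ => ?_) (fun p hp => ?_)
  · obtain ⟨hr, h⟩ := (mem_extensions _ _ _ _ _).1 hp
    exact mem_addableNodes.2 ⟨hr, p.2, h⟩
  · exact Prod.ext hpq (by rw [hadd p hp, hadd q hq, hpq])
  · obtain ⟨hr, mu, h⟩ := mem_addableNodes.1 hγ
    exact ⟨(γ, mu), (mem_extensions _ _ _ _ _).2 ⟨hr, h⟩, rfl⟩
  · rw [← hadd p hp]

open Classical in
theorem f_basisVec_addNodes (he : 2 ≤ e) (nu : Bipartition) {S : Finset Node}
    (hS : S ⊆ nu.addableNodes e m i) :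
    f e m i (basisVec (nu.addNodes S)) = ∑ γ ∈ nu.addableNodes e m i \ S,
      ((v ^ (nu.belowCount e m i γ - 2 * ((S.filter fun δ => γ.pos < δ.pos).card : ℤ)) :
        (RatFunc ℚ)ˣ) : RatFunc ℚ) • basisVec (nu.addNodes (insert γ S)) := by
  have h := addsNodes_addNodes fun γ hγ => mem_addableNodes.1 (hS hγ)
  have hset : (nu.addNodes S).addableNodes e m i = nu.addableNodes e m i \ S := by
    ext γ
    simp [h.isAddable_iff he]
  rw [f_basisVec he, hset]
  refine Finset.sum_congr rfl fun γ hγ => ?_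
  rw [Finset.mem_sdiff] at hγ
  have hγ' : (nu.addNodes S).IsAddable e m i γ :=
    (h.isAddable_iff he γ).2 ⟨mem_addableNodes.1 hγ.1, hγ.2⟩
  have h1 := addsNodes_addNodes (e := e) (m := m) (i := i) (nu := nu.addNodes S) (S := {γ})
    (by simpa using hγ')
  have h2 := addsNodes_addNodes (e := e) (m := m) (i := i) (nu := nu) (S := insert γ S)
    fun δ hδ => by
      rcases Finset.mem_insert.1 hδ with rfl | hδ
      · exact mem_addableNodes.1 hγ.1
      · exact mem_addableNodes.1 (hS hδ)
  have heq : (nu.addNodes S).addNodes {γ} = nu.addNodes (insert γ S) := by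
    refine diagram_injective (Set.ext fun δ => ?_)
    rw [h1.mem_iff, h2.mem_iff, h.mem_iff, Finset.mem_insert, Finset.mem_singleton]
    tauto
  rw [heq, h.belowCount_eq he]

/-- The exponent of `v` in the coefficient of `nu ⊔ S` in the divided power of `f_i` applied
to `nu`. -/
noncomputable def exponent (e m : ℕ) (i : ZMod e) (nu : Bipartition) (S : Finset Node) : ℤ :=
  ∑ γ ∈ S, nu.belowCount e m i γ - (S.card.choose 2 : ℤ)

/-- Summing over a set of `a + 1` addable nodes, of which the last one to be adjoined varies,
yields the quantum integer `[a + 1]`. -/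
theorem sum_exponent_erase [DecidableEq Node] (nu : Bipartition) {S : Finset Node} {a : ℕ}
    (hcard : S.card = a + 1) (hinj : Set.InjOn Node.pos (S : Set Node)) :
    ∑ γ ∈ S, ((v ^ (exponent e m i nu (S.erase γ) + (nu.belowCount e m i γ -
      2 * (((S.erase γ).filter fun δ => γ.pos < δ.pos).card : ℤ))) : (RatFunc ℚ)ˣ) : RatFunc ℚ) =
      qInt (a + 1) * ((v ^ exponent e m i nu S : (RatFunc ℚ)ˣ) : RatFunc ℚ) := by
  rw [qInt_eq_sum, ← hcard, ← Finset.sum_card_filter_key_lt Node.pos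
    (fun k => ((v ^ ((a : ℤ) - 2 * k) : (RatFunc ℚ)ˣ) : RatFunc ℚ)) S hinj, Finset.sum_mul]
  refine Finset.sum_congr rfl fun γ hγ => ?_
  rw [← Units.val_mul, ← zpow_add]
  congr 2
  have h1 : (S.erase γ).filter (fun δ => γ.pos < δ.pos) = S.filter fun δ => γ.pos < δ.pos := by
    rw [Finset.filter_erase, Finset.erase_eq_of_notMem (by simp)]
  have h2 := Finset.sum_erase_add S (nu.belowCount e m i) hγ
  rw [exponent, exponent, h1, ← h2, Finset.card_erase_of_mem hγ, hcard, Nat.add_sub_cancel,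
    Nat.choose_succ_succ' a 1, Nat.choose_one_right]
  push_cast
  ring

/-- The `a`-th power of `f_i` adjoins sets of `a` addable `i`-nodes. The `a!` orders in which
a given set is adjoined contribute different powers of `v`, whose sum is the factor `[a]!`. -/
theorem f_pow_basisVec (he : 2 ≤ e) (nu : Bipartition) (a : ℕ) :
    (f e m i ^ a) (basisVec nu) = qFactorial a •
      ∑ S ∈ (nu.addableNodes e m i).powersetCard a,
        ((v ^ exponent e m i nu S : (RatFunc ℚ)ˣ) : RatFunc ℚ) • basisVec (nu.addNodes S) := by
  classical
  induction a with
  | zero =>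
    have h : nu.addNodes ∅ = nu :=
      diagram_injective (Set.ext fun γ => by
        rw [(addsNodes_addNodes (e := e) (m := m) (i := i) (nu := nu) (S := ∅)
          (by simp)).mem_iff]
        simp)
    simp [qFactorial, exponent, h]
  | succ a ih =>
    rw [pow_succ', Module.End.mul_apply, ih, map_smul, map_sum, qFactorial_succ,
      mul_smul]
    congr 1
    rw [Finset.smul_sum]
    have hstep : ∀ S ∈ (nu.addableNodes e m i).powersetCard a,
        f e m i (((v ^ exponent e m i nu S : (RatFunc ℚ)ˣ) : RatFunc ℚ) •
          basisVec (nu.addNodes S)) = ∑ γ ∈ nu.addableNodes e m i \ S,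
        ((v ^ (exponent e m i nu S + (nu.belowCount e m i γ -
          2 * ((S.filter fun δ => γ.pos < δ.pos).card : ℤ))) : (RatFunc ℚ)ˣ) : RatFunc ℚ) •
            basisVec (nu.addNodes (insert γ S)) := fun S hS => by
      rw [map_smul, f_basisVec_addNodes he nu (Finset.mem_powersetCard.1 hS).1, Finset.smul_sum]
      refine Finset.sum_congr rfl fun γ _ => ?_
      rw [smul_smul, ← Units.val_mul, ← zpow_add]
    rw [Finset.sum_congr rfl hstep]
    have hlast : ∀ S ∈ (nu.addableNodes e m i).powersetCard (a + 1),
        qInt (a + 1) • ((v ^ exponent e m i nu S : (RatFunc ℚ)ˣ) : RatFunc ℚ) •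
          basisVec (nu.addNodes S) = ∑ γ ∈ S,
        ((v ^ (exponent e m i nu (S.erase γ) + (nu.belowCount e m i γ -
          2 * (((S.erase γ).filter fun δ => γ.pos < δ.pos).card : ℤ))) : (RatFunc ℚ)ˣ) :
            RatFunc ℚ) • basisVec (nu.addNodes S) := fun S hS => by
      obtain ⟨hsub, hcard⟩ := Finset.mem_powersetCard.1 hS
      rw [← Finset.sum_smul, sum_exponent_erase nu hcard, smul_smul]
      exact (injOn_pos_isAddable e m i nu).mono fun γ hγ => mem_addableNodes.1 (hsub hγ)
    rw [Finset.sum_congr rfl hlast, Finset.sum_sigma', Finset.sum_sigma']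
    -- A set of `a` nodes with a further node amounts to a set of `a + 1` nodes with one of them.
    refine Finset.sum_bij' (fun p _ => ⟨insert p.2 p.1, p.2⟩) (fun p _ => ⟨p.1.erase p.2, p.2⟩)
      ?_ ?_ ?_ ?_ ?_
    · rintro ⟨S, γ⟩ hp
      simp only [Finset.mem_sigma, Finset.mem_powersetCard, Finset.mem_sdiff] at hp ⊢
      obtain ⟨⟨h1, h2⟩, h3, h4⟩ := hp
      exact ⟨⟨Finset.insert_subset h3 h1, by rw [Finset.card_insert_of_notMem h4, h2]⟩,
        Finset.mem_insert_self _ _⟩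
    · rintro ⟨S, γ⟩ hp
      simp only [Finset.mem_sigma, Finset.mem_powersetCard, Finset.mem_sdiff] at hp ⊢
      obtain ⟨⟨h1, h2⟩, h3⟩ := hp
      exact ⟨⟨(Finset.erase_subset _ _).trans h1, by
        rw [Finset.card_erase_of_mem h3, h2, Nat.add_sub_cancel]⟩, h1 h3,
        Finset.notMem_erase _ _⟩
    · rintro ⟨S, γ⟩ hp
      simp only [Finset.mem_sigma, Finset.mem_sdiff] at hp
      simp [Finset.erase_insert hp.2.2]
    · rintro ⟨S, γ⟩ hp
      simp only [Finset.mem_sigma] at hp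
      simp [Finset.insert_erase hp.2]
    · rintro ⟨S, γ⟩ hp
      simp only [Finset.mem_sigma, Finset.mem_sdiff] at hp
      simp only [Finset.erase_insert hp.2.2]

theorem dividedPower_basisVec (he : 2 ≤ e) (nu : Bipartition) (a : ℕ) :
    dividedPower e m i a (basisVec nu) = ∑ S ∈ (nu.addableNodes e m i).powersetCard a,
      ((v ^ exponent e m i nu S : (RatFunc ℚ)ˣ) : RatFunc ℚ) • basisVec (nu.addNodes S) := by
  rw [dividedPower, LinearMap.smul_apply, f_pow_basisVec he,
    inv_smul_smul₀ (qFactorial_ne_zero a)]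

/-- Below a node of an admissible sequence `R` the only addable `i`-nodes of `mu` are nodes of `R`,
and there are no removable ones, so the values of `belowCount` at the nodes of `R` are
`0, …, |R| - 1`. -/
theorem exponent_eq_zero (he : 2 ≤ e) {lam mu : Bipartition} {R : Finset Node}
    (hR : lam.IsAdmissible e m i R) (h : AddsNodes e m i mu R lam) :
    exponent e m i mu R = 0 := by
  classical
  have hbelow : ∀ γ ∈ R, mu.belowCount e m i γ = (R.filter fun δ => γ.pos < δ.pos).card := by
    intro γ hγ
    have h1 := h.belowCount_eq he γ
    have h2 : lam.belowCount e m i γ = - ((R.filter fun δ => γ.pos < δ.pos).card : ℤ) := by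
      have hA : {δ | lam.IsAddable e m i δ ∧ γ.Above δ} = ∅ := by
        refine Set.eq_empty_of_forall_notMem fun δ hδ => ?_
        exact lt_asymm ((Node.above_iff_pos_lt _ _).1 hδ.2)
          ((Node.above_iff_pos_lt _ _).1 (hR.addable_above δ hδ.1 γ hγ))
      have hB : {δ | lam.IsRemovable e m i δ ∧ γ.Above δ} =
          (R.filter fun δ => γ.pos < δ.pos : Finset Node) := by
        ext δ
        simp only [Set.mem_ofPred_eq, Finset.coe_filter, Node.above_iff_pos_lt]
        refine ⟨fun hδ => ⟨?_, hδ.2⟩, fun hδ => ⟨hR.removable δ hδ.1, hδ.2⟩⟩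
        by_contra hδR
        exact lt_asymm hδ.2 ((Node.above_iff_pos_lt _ _).1 (hR.lowest δ hδ.1 hδR γ hγ))
      rw [belowCount, hA, hB, Set.ncard_coe_finset, Set.ncard_empty]
      simp
    omega
  rw [exponent, Finset.sum_congr rfl hbelow, Finset.sum_card_filter_key_lt Node.pos
    (fun k => (k : ℤ)) R ((injOn_pos_isAddable e m i mu).mono fun γ hγ => h.isAddable he hγ),
    ← Nat.cast_sum, Finset.sum_range_id, Nat.choose_two_right, sub_self]

/-! ### Unitriangularity -/

/-- The vector `x` is `lam` plus a combination of bipartitions smaller than `lam`, all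
coefficients being Laurent polynomials with coefficients in `ℕ`. -/
structure IsUnitriangular (lam : Bipartition) (x : Fock) : Prop where
  self : x lam = 1
  mem_range : ∀ nu, x nu ∈ ofLaurent.rangeS
  lt_of_ne_zero : ∀ nu, x nu ≠ 0 → nu = lam ∨ RevLexLT nu lam

theorem IsUnitriangular.basisVec (lam : Bipartition) : IsUnitriangular lam (basisVec lam) where
  self := by simp [Fock.basisVec]
  mem_range nu := by
    classical
    rw [Fock.basisVec, Finsupp.single_apply]
    split_ifs
    exacts [one_mem _, zero_mem _]
  lt_of_ne_zero nu h := by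
    classical
    rw [Fock.basisVec, Finsupp.single_apply] at h
    exact Or.inl (by_contra fun hne => h (if_neg (Ne.symm hne)))

theorem v_zpow_mem_rangeS (n : ℤ) : ((v ^ n : (RatFunc ℚ)ˣ) : RatFunc ℚ) ∈ ofLaurent.rangeS :=
  ⟨LaurentPolynomial.T n, LaurentPolynomial.eval₂_T _ _ _⟩

open Classical in
theorem dividedPower_apply (he : 2 ≤ e) (a : ℕ) (x : Fock) (nu' : Bipartition) :
    dividedPower e m i a x nu' = ∑ nu ∈ x.support, x nu *
      ∑ S ∈ (nu.addableNodes e m i).powersetCard a,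
        if nu.addNodes S = nu' then ((v ^ exponent e m i nu S : (RatFunc ℚ)ˣ) : RatFunc ℚ)
        else 0 := by
  have hx : x = ∑ nu ∈ x.support, x nu • Fock.basisVec nu := by
    conv_lhs => rw [← Finsupp.sum_single x]
    simp [Finsupp.sum, Fock.basisVec]
  conv_lhs => rw [hx]
  simp only [map_sum, map_smul, dividedPower_basisVec he, Finsupp.finsetSum_apply,
    Finsupp.smul_apply, smul_eq_mul]
  refine Finset.sum_congr rfl fun nu _ => ?_
  congr 1
  refine Finset.sum_congr rfl fun S _ => ?_
  simp [Fock.basisVec, Finsupp.single_apply]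

theorem IsUnitriangular.dividedPower (he : 2 ≤ e) {lam mu : Bipartition} {R : Finset Node}
    (hR : lam.IsAdmissible e m i R) (h : AddsNodes e m i mu R lam) {x : Fock}
    (hx : IsUnitriangular mu x) : IsUnitriangular lam (dividedPower e m i R.card x) := by
  classical
  have hadds : ∀ nu : Bipartition, ∀ S ∈ (nu.addableNodes e m i).powersetCard R.card,
      AddsNodes e m i nu S (nu.addNodes S) ∧ S.card = R.card := fun nu S hS =>
    ⟨addsNodes_addNodes fun γ hγ =>
      mem_addableNodes.1 ((Finset.mem_powersetCard.1 hS).1 hγ), (Finset.mem_powersetCard.1 hS).2⟩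
  -- The bipartition `lam` arises only by adjoining `R` to `mu`.
  have hcmp : ∀ nu : Bipartition, x nu ≠ 0 → ∀ S ∈ (nu.addableNodes e m i).powersetCard R.card,
      nu = mu ∧ S = R ∨ RevLexLT (nu.addNodes S) lam := by
    intro nu hnu S hS
    obtain ⟨h', hcard⟩ := hadds nu S hS
    rcases hx.lt_of_ne_zero nu hnu with rfl | hlt
    · by_cases hSR : S = R
      · exact Or.inl ⟨rfl, hSR⟩
      · exact Or.inr (hR.revLexLT_of_ne he h h' hcard hSR)
    · exact Or.inr (hR.revLexLT_of_revLexLT he h h' hcard hlt)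
  refine ⟨?_, fun nu' => ?_, fun nu' hne => ?_⟩
  · rw [dividedPower_apply he, Finset.sum_eq_single mu, hx.self, one_mul,
      Finset.sum_eq_single R, if_pos (h.eq_addNodes he).symm, exponent_eq_zero he hR h]
    · simp
    · intro S hS hSR
      refine if_neg ((hcmp mu ?_ S hS).resolve_left fun h => hSR h.2).ne
      rw [hx.self]
      exact one_ne_zero
    · intro hnot
      refine (hnot (Finset.mem_powersetCard.2 ⟨fun γ hγ => ?_, rfl⟩)).elim
      exact mem_addableNodes.2 (h.isAddable he hγ)
    · intro nu hnu hne
      rw [Finset.sum_eq_zero, mul_zero]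
      intro S hS
      exact if_neg ((hcmp nu (Finsupp.mem_support_iff.1 hnu) S hS).resolve_left
        fun h => hne h.1).ne
    · intro hnot
      rw [Finsupp.notMem_support_iff.1 hnot, zero_mul]
  · rw [dividedPower_apply he]
    refine sum_mem fun nu _ => mul_mem (hx.mem_range nu) (sum_mem fun S _ => ?_)
    split_ifs
    exacts [v_zpow_mem_rangeS _, zero_mem _]
  · rw [dividedPower_apply he] at hne
    obtain ⟨nu, hnu, hne⟩ := Finset.exists_ne_zero_of_sum_ne_zero hne
    obtain ⟨S, hS, hne⟩ := Finset.exists_ne_zero_of_sum_ne_zero (right_ne_zero_of_mul hne)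
    obtain rfl : nu.addNodes S = nu' := by_contra fun h => hne (if_neg h)
    refine (hcmp nu (Finsupp.mem_support_iff.1 hnu) S hS).imp_left ?_
    rintro ⟨rfl, rfl⟩
    exact (h.eq_addNodes he).symm

theorem isUnitriangular_of_isOptimalSeq (he : 2 ≤ e) {lam : Bipartition}
    {L : List (ZMod e × ℕ)} (hL : lam.IsOptimalSeq e m L) :
    IsUnitriangular lam
      ((L.map fun p => Fock.dividedPower e m p.1 p.2).prod (Fock.basisVec ⊥)) := by
  induction hL with
  | nil => exact IsUnitriangular.basisVec ⊥
  | cons lam mu i R L hadm hdisj hunion _ ih =>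
    rw [List.map_cons, List.prod_cons, Module.End.mul_apply]
    refine ih.dividedPower he hadm ⟨fun γ hγ => (hadm.removable γ hγ).1, fun γ hγ hmem => ?_,
      fun γ => ?_⟩
    · exact Set.disjoint_left.1 hdisj hmem hγ
    · rw [hunion]
      rfl

theorem IsUnitriangular.exists_eq_add {lam : Bipartition} {x : Fock}
    (hx : IsUnitriangular lam x) :
    ∃ c : Bipartition →₀ ℕ[T;T⁻¹], (∀ nu ∈ c.support, RevLexLT nu lam) ∧
      x = Fock.basisVec lam + c.sum fun nu p => ofLaurent p • Fock.basisVec nu := by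
  classical
  choose g hg using hx.mem_range
  refine ⟨Finsupp.onFinset (x.support.erase lam)
    (fun nu => if nu ∈ x.support.erase lam then g nu else 0) (fun nu h => ?_), fun nu hnu => ?_, ?_⟩
  · by_contra hnot
    exact h (if_neg hnot)
  · have hmem := Finsupp.support_onFinset_subset hnu
    rw [Finset.mem_erase, Finsupp.mem_support_iff] at hmem
    exact (hx.lt_of_ne_zero nu hmem.2).resolve_left hmem.1
  · have hlam : lam ∈ x.support := by
      rw [Finsupp.mem_support_iff, hx.self]
      exact one_ne_zero
    rw [Finsupp.onFinset_sum _ (by simp)]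
    conv_lhs => rw [← Finsupp.sum_single x, Finsupp.sum, ← Finset.add_sum_erase _ _ hlam, hx.self]
    congr 1
    refine Finset.sum_congr rfl fun nu hnu => ?_
    rw [if_pos hnu, hg, Fock.basisVec, Finsupp.smul_single_one]

end Fock

theorem mainTheorem2 (e m : ℕ) (he : 2 ≤ e) (hm : m < e) (lam : Bipartition)
    (hlam : lam.IsKleshchev e m) (L : List (ZMod e × ℕ)) (hL : lam.IsOptimalSeq e m L) :
    ∃ c : Bipartition →₀ ℕ[T;T⁻¹],
      (∀ nu ∈ c.support, Bipartition.RevLexLT nu lam) ∧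
        (L.map fun p => Fock.dividedPower e m p.1 p.2).prod (Fock.basisVec ⊥) =
          Fock.basisVec lam + c.sum fun nu p => Fock.ofLaurent p • Fock.basisVec nu :=
  (Fock.isUnitriangular_of_isOptimalSeq he hL).exists_eq_add
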